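/- Let $n\in\mathbb N$, let $\mathbb D^n$ be the open unit polydisc and $\mathbb T^n$ the $n$-torus, and let $C(z,w)=\prod_{j=1}^n (1-z_j\overline{w_j})^{-1}$. For a non-constant holomorphic $b:\mathbb D^n\to\mathbb D$ and $\alpha\in\mathbb T$, let $\sigma_\alpha[b]$ be the Clark--Aleksandrov measure, i.e. the unique finite positive Borel measure on $\mathbb T^n$ with $$\int_{\mathbb T^n}\prod_{j=1}^n\frac{1-|z_j|^2}{|\zeta_j-z_j|^2}\,d\sigma_\alpha[b](\zeta)=\frac{1-|b(z)|^2}{|\alpha-b(z)|^2},\qquad z\in\mathbb D^n.$$ Let $\mathcal H(b)$ be the de Branges--Rovnyak space, i.e. the reproducing kernel Hilbert space on $\mathbb D^n$ with kernel $k_b(z,w)=(1-b(z)\overline{b(w)})\,C(z,w)$. For a finite positive Borel measure $\sigma$ on $\mathbb T^n$ let $H^2(\sigma)$ be the closed linear span of the holomorphic polynomials in $L^2(\sigma)$. Let $A(\mathbb D^n)$ be the polydisc algebra (the continuous functions on $\overline{\mathbb D^n}$ that are holomorphic in $\mathbb D^n$), and let $A(\mathbb D^n)^\perp$ be the set of complex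 Borel measures $\nu$ on $\mathbb T^n$ with $\int f\,d\nu=0$ for all $f\in A(\mathbb D^n)$. A Borel set $N\subset\mathbb T^n$ is a null set of $A(\mathbb D^n)^\perp$ if $|\nu|(N)=0$ for all $\nu\in A(\mathbb D^n)^\perp$. Let $b_1,b_2:\mathbb D^n\to\mathbb D$ be non-constant holomorphic functions. (1) Let $\sigma^1=\sigma_1[b_1]$ and $\sigma^2=\sigma_1[b_2]$. For every $w\in\mathbb D^n$, $$\frac{1-b_2}{1-b_1}\,k_{b_1}(\cdot,w)\in\mathcal H(b_2)$$ if and only if there is $q_w\in H^2(\sigma^2)$ such that the complex conjugate of the measure $C(\cdot,w)\sigma^1-q_w\sigma^2$ belongs to $A(\mathbb D^n)^\perp$ (equivalently, $C(\cdot,w)\sigma^1-q_w\sigma^2$ annihilates $\overline f$ for every $f\in A(\mathbb D^n)$). (2) Let $\alpha\in\mathbb T$, $\sigma^1=\sigma_\alpha[b_1]$ and $\sigma^2=\sigma_\alpha[b_2]$. If $\frac{\alpha-b_2}{\alpha-b_1}\,k_{b_1}(\cdot,w)\in\mathcal H(b_2)$ for some $w\in\mathbb D^n$, then for every null set $N$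 of $A(\mathbb D^n)^\perp$ we have $\sigma^1|_N\ll\sigma^2$ and $\frac{d\sigma^1|_N}{d\sigma^2}\in L^2(\sigma^2)$. -/

import Mathlib

open MeasureTheory ComplexConjugate

noncomputable section

namespace ClarkTorus

/-- The open unit polydisc `𝔻ⁿ`. -/
def polydisc (n : ℕ) : Set (Fin n → ℂ) := {z | ∀ j, ‖z j‖ < 1}

/-- The closed unit polydisc. -/
def closedPolydisc (n : ℕ) : Set (Fin n → ℂ) := {z | ∀ j, ‖z j‖ ≤ 1}

/-- The torus `𝕋ⁿ`, with its product topology and Borel σ-algebra. -/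
abbrev Torus (n : ℕ) : Type := Fin n → Metric.sphere (0 : ℂ) 1

/-- A point of the torus as a point of `ℂⁿ`. -/
def Torus.toVec {n : ℕ} (ζ : Torus n) : Fin n → ℂ := fun j => (ζ j : ℂ)

/-- The product Cauchy kernel `C(z, w) = ∏ⱼ 1 / (1 - zⱼ * conj wⱼ)`. -/
def cauchyKernel {n : ℕ} (z w : Fin n → ℂ) : ℂ := ∏ j, 1 / (1 - z j * conj (w j))

/-- The Poisson kernel `∏ⱼ (1 - |zⱼ|²) / |ζⱼ - zⱼ|²` of the polydisc. -/
def polydiscPoissonKernel {n : ℕ} (z ζ : Fin n → ℂ) : ℝ := ∏ j, (1 - ‖z j‖ ^ 2) / ‖ζ j - z j‖ ^ 2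

/-- `b` is a non-constant holomorphic function `𝔻ⁿ → 𝔻` (its values off `𝔻ⁿ` play no role). -/
structure IsNonconstantSelfMap {n : ℕ} (b : (Fin n → ℂ) → ℂ) : Prop where
  differentiableOn : DifferentiableOn ℂ b (polydisc n)
  mapsTo : ∀ z ∈ polydisc n, ‖b z‖ < 1
  nonconstant : ¬ ∃ c : ℂ, ∀ z ∈ polydisc n, b z = c

/-- `σ` is the Clark-Aleksandrov measure `σ_α[b]`: the (unique) finite positive Borel measure on
`𝕋ⁿ` whose Poisson integral is `(1 - |b|²) / |α - b|²` on `𝔻ⁿ`. -/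
structure IsClarkMeasure {n : ℕ} (α : ℂ) (b : (Fin n → ℂ) → ℂ) (σ : Measure (Torus n)) :
    Prop where
  isFiniteMeasure : IsFiniteMeasure σ
  poisson_eq : ∀ z ∈ polydisc n,
    ∫ ζ, polydiscPoissonKernel z ζ.toVec ∂σ = (1 - ‖b z‖ ^ 2) / ‖α - b z‖ ^ 2

/-- The kernel `k_b(z, w) = (1 - b(z) * conj b(w)) * C(z, w)`. -/
def dbrKernel {n : ℕ} (b : (Fin n → ℂ) → ℂ) (z w : Fin n → ℂ) : ℂ :=
  (1 - b z * conj (b w)) * cauchyKernel z w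

/-- `k_b` on `𝔻ⁿ`, in the operator-valued form used for reproducing kernel Hilbert spaces: the
scalar `k_b(z, w)` acts on `ℂ` by multiplication. -/
def dbrMatrix {n : ℕ} (b : (Fin n → ℂ) → ℂ) : Matrix (polydisc n) (polydisc n) (ℂ →L[ℂ] ℂ) :=
  Matrix.of fun z w => dbrKernel b z w • ContinuousLinearMap.id ℂ ℂ

/-- The de Branges-Rovnyak space `H(b)`, as a set of functions on `𝔻ⁿ`: the functions that belong
to the reproducing kernel Hilbert space with the positive semidefinite kernel `k_b`. -/
def deBrangesRovnyak {n : ℕ} (b : (Fin n → ℂ) → ℂ) : Set (polydisc n → ℂ) :=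
  {f | ∃ h : (dbrMatrix b).PosSemidef,
    haveI : Fact (dbrMatrix b).PosSemidef := ⟨h⟩
    ∃ F : RKHS.OfKernel (dbrMatrix b), ∀ z, F z = f z}

/-- `H²(σ)`: the closed linear span of the holomorphic polynomials in `L²(σ)`. -/
def hardySpace {n : ℕ} (σ : Measure (Torus n)) : Submodule ℂ (Lp ℂ 2 σ) :=
  (Submodule.span ℂ {g : Lp ℂ 2 σ | ∃ p : MvPolynomial (Fin n) ℂ,
    g =ᵐ[σ] fun ζ : Torus n => MvPolynomial.eval ζ.toVec p}).topologicalClosure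

/-- The polydisc algebra `A(𝔻ⁿ)`. -/
def polydiscAlgebra (n : ℕ) : Set ((Fin n → ℂ) → ℂ) :=
  {f | ContinuousOn f (closedPolydisc n) ∧ DifferentiableOn ℂ f (polydisc n)}

/-- `A(𝔻ⁿ)^⊥`: the complex Borel measures on `𝕋ⁿ` that annihilate `A(𝔻ⁿ)`. -/
def annihilator (n : ℕ) : Set (ComplexMeasure (Torus n)) :=
  {ν | ∀ f ∈ polydiscAlgebra n,
    VectorMeasure.integral ν (fun ζ : Torus n => f ζ.toVec) (ContinuousLinearMap.mul ℝ ℂ) = 0}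

/-- The complex conjugate of a complex measure. -/
def conjMeasure {n : ℕ} (ν : ComplexMeasure (Torus n)) : ComplexMeasure (Torus n) :=
  ν.mapRange (starRingEnd ℂ).toAddMonoidHom Complex.continuous_conj

/-- `N` is a null set for `A(𝔻ⁿ)^⊥`: a Borel set with `|ν|(N) = 0` for all `ν ∈ A(𝔻ⁿ)^⊥`. -/
def IsAnnihilatorNull {n : ℕ} (N : Set (Torus n)) : Prop :=
  MeasurableSet N ∧ ∀ ν ∈ annihilator n, ν.variation N = 0

end ClarkTorus

end

/-! For fixed `w` both sides of the Poisson identity are the diagonal values of kernels holomorphic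
in `z` and antiholomorphic in `w`, so the identity polarizes: `(1 - conj α * b z) * (1 - α * conj (b
w))` times the `L²(σ)` inner product of the Cauchy kernels at `z` and `w` equals `k_b(z, w)`. Thus
`z ↦ (1 - α * conj (b z)) • C(·, z)` is a feature map for `k_b`, and `H(b)` consists of the
functions `(1 - conj α * b) * ∫ conj C(ζ, ·) q dσ` with `q ∈ H²(σ)`
(`IsClarkMeasure.mem_deBrangesRovnyak_iff`).

After cancelling `1 - conj α * b₂` and absorbing a constant into `q`, membership of the multiplied
kernel in `H(b₂)` says that `C(·, w)σ₁` and `qσ₂` have the same Cauchy integral. Equivalently, the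
conjugate of their difference kills every `C(·, z)`; by the iterated Cauchy formula and dilation it
then kills the whole polydisc algebra (`map_polydiscAlgebra_eq_zero`). This is (1), for every
unimodular `α` and each single `w`.

For (2), the annihilating measure vanishes on all Borel subsets of `N`, so `C(·, w)σ₁ = qσ₂` there.
Since `C(·, w)` is continuous and zero-free on the compact torus, dividing by it gives absolute
continuity and an `L²` density. -/

noncomputable section

namespace ClarkTorus

open Filter Topology
open scoped ENNReal

/-! ### Integrals against complex measures given by densities. -/

section VectorMeasureIntegral

variable {X : Type*} [MeasurableSpace X]

lemma variation_withDensityᵥ_le (μ : Measure X) {h : X → ℂ} (hh : Integrable h μ) :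
    (μ.withDensityᵥ h).variation ≤ μ.withDensity (fun x => ‖h x‖ₑ) := by
  refine VectorMeasure.variation_le_of_forall_enorm_le fun E hE => ?_
  rw [withDensityᵥ_apply hh hE, withDensity_apply _ hE]
  exact enorm_integral_le_lintegral_enorm _

lemma isFiniteMeasure_variation_withDensityᵥ (μ : Measure X) {h : X → ℂ} (hh : Integrable h μ) :
    IsFiniteMeasure (μ.withDensityᵥ h).variation :=
  have := isFiniteMeasure_withDensity (μ := μ) (f := fun x => ‖h x‖ₑ) hh.2.ne
  isFiniteMeasure_of_le _ (variation_withDensityᵥ_le μ hh)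

lemma integral_withDensityᵥ_simpleFunc (μ : Measure X) {h : X → ℂ} (hh : Integrable h μ)
    (f : SimpleFunc X ℂ) :
    VectorMeasure.integral (μ.withDensityᵥ h) f (ContinuousLinearMap.mul ℝ ℂ) =
      ∫ x, f x * h x ∂μ := by
  have := isFiniteMeasure_variation_withDensityᵥ μ hh
  have hint : ∀ f : SimpleFunc X ℂ, Integrable (fun x => f x * h x) μ := fun f => by
    obtain ⟨C, hC⟩ := f.exists_forall_norm_le
    exact hh.bdd_mul f.stronglyMeasurable.aestronglyMeasurable (ae_of_all _ hC)
  induction f using SimpleFunc.induction with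
  | const c hs =>
    rename_i s
    have h1 : ⇑(SimpleFunc.piecewise s hs (SimpleFunc.const X c) (SimpleFunc.const X 0)) =
        s.indicator (fun _ => c) := by
      ext x; simp [Set.indicator, Set.piecewise]
    rw [h1, VectorMeasure.integral_indicator hs, VectorMeasure.setIntegral_const,
      withDensityᵥ_apply hh hs, ContinuousLinearMap.mul_apply', ← integral_const_mul,
      ← integral_indicator hs]
    congr 1
    ext x
    by_cases hx : x ∈ s <;> simp [hx]
  | add _ hf hg =>
    rename_i f g _
    have hi : ∀ f : SimpleFunc X ℂ, (μ.withDensityᵥ h).Integrable f := fun f =>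
      f.integrable_of_isFiniteMeasure
    rw [SimpleFunc.coe_add, VectorMeasure.integral_add (hi f) (hi g), hf, hg,
      ← integral_add (hint f) (hint g)]
    simp [add_mul]

/-- Passes from simple functions to bounded ones by dominated convergence on both sides. It turns
the vector-measure integral in `annihilator` into an ordinary Bochner integral. -/
lemma integral_withDensityᵥ (μ : Measure X) {h f : X → ℂ} (hh : Integrable h μ)
    (hf : StronglyMeasurable f) {C : ℝ} (hC : ∀ x, ‖f x‖ ≤ C) :
    VectorMeasure.integral (μ.withDensityᵥ h) f (ContinuousLinearMap.mul ℝ ℂ) =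
      ∫ x, f x * h x ∂μ := by
  have := isFiniteMeasure_variation_withDensityᵥ μ hh
  rcases isEmpty_or_nonempty X with hX | ⟨⟨x₀⟩⟩
  · rw [VectorMeasure.integral_of_isEmpty, integral_of_isEmpty]
  have hC0 : 0 ≤ C := (norm_nonneg _).trans (hC x₀)
  have hb := hf.norm_approxBounded_le (c := C) hC0
  have h1 : Tendsto (fun n => VectorMeasure.integral (μ.withDensityᵥ h) (hf.approxBounded C n)
      (ContinuousLinearMap.mul ℝ ℂ)) atTop
      (𝓝 (VectorMeasure.integral (μ.withDensityᵥ h) f (ContinuousLinearMap.mul ℝ ℂ))) :=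
    VectorMeasure.tendsto_integral_filter_of_norm_le_const
      (Eventually.of_forall fun n => (hf.approxBounded C n).stronglyMeasurable.aestronglyMeasurable)
      ⟨C, Eventually.of_forall fun n => ae_of_all _ (hb n)⟩
      (ae_of_all _ fun x => hf.tendsto_approxBounded_of_norm_le (hC x))
  have h2 : Tendsto (fun n => ∫ x, hf.approxBounded C n x * h x ∂μ) atTop
      (𝓝 (∫ x, f x * h x ∂μ)) :=
    tendsto_integral_of_dominated_convergence (fun x => C * ‖h x‖)
      (fun n => (hf.approxBounded C n).stronglyMeasurable.aestronglyMeasurable.mul hh.1)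
      (hh.norm.const_mul C)
      (fun n => ae_of_all _ fun x => by rw [norm_mul]; gcongr; exact hb n x)
      (ae_of_all _ fun x => (hf.tendsto_approxBounded_of_norm_le (hC x)).mul_const _)
  refine tendsto_nhds_unique h1 (h2.congr fun n => ?_)
  rw [integral_withDensityᵥ_simpleFunc μ hh]

end VectorMeasureIntegral

lemma conjMeasure_apply {n : ℕ} (ν : ComplexMeasure (Torus n)) (E : Set (Torus n)) :
    conjMeasure ν E = conj (ν E) := rfl

lemma conjMeasure_withDensityᵥ {n : ℕ} (μ : Measure (Torus n)) {h : Torus n → ℂ}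
    (hh : Integrable h μ) :
    conjMeasure (μ.withDensityᵥ h) = μ.withDensityᵥ (fun x => conj (h x)) := by
  ext E hE
  have hh' : Integrable (fun x => conj (h x)) μ :=
    (LinearIsometryEquiv.integrable_comp_iff RCLike.conjLIE).mpr hh
  rw [conjMeasure_apply, withDensityᵥ_apply hh hE, withDensityᵥ_apply hh' hE, integral_conj]

lemma conjMeasure_sub {n : ℕ} (ν₁ ν₂ : ComplexMeasure (Torus n)) :
    conjMeasure (ν₁ - ν₂) = conjMeasure ν₁ - conjMeasure ν₂ := by
  ext E hE
  simp [conjMeasure_apply]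

lemma integral_conjMeasure_withDensityᵥ_sub {n : ℕ} (σ₁ σ₂ : Measure (Torus n))
    {h₁ h₂ f : Torus n → ℂ} (hh₁ : Integrable h₁ σ₁) (hh₂ : Integrable h₂ σ₂)
    (hf : StronglyMeasurable f) {C : ℝ} (hC : ∀ x, ‖f x‖ ≤ C) :
    VectorMeasure.integral (conjMeasure (σ₁.withDensityᵥ h₁ - σ₂.withDensityᵥ h₂)) f
      (ContinuousLinearMap.mul ℝ ℂ) =
      ∫ x, f x * conj (h₁ x) ∂σ₁ - ∫ x, f x * conj (h₂ x) ∂σ₂ := by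
  have h₁' : Integrable (fun x => conj (h₁ x)) σ₁ :=
    (LinearIsometryEquiv.integrable_comp_iff RCLike.conjLIE).mpr hh₁
  have h₂' : Integrable (fun x => conj (h₂ x)) σ₂ :=
    (LinearIsometryEquiv.integrable_comp_iff RCLike.conjLIE).mpr hh₂
  have := isFiniteMeasure_variation_withDensityᵥ σ₁ h₁'
  have := isFiniteMeasure_variation_withDensityᵥ σ₂ h₂'
  have hi : ∀ (m : Measure (Torus n)) [IsFiniteMeasure m], Integrable f m := fun m _ =>
    Integrable.of_bound hf.aestronglyMeasurable C (ae_of_all _ hC)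
  rw [conjMeasure_sub, conjMeasure_withDensityᵥ _ hh₁, conjMeasure_withDensityᵥ _ hh₂,
    VectorMeasure.integral_sub_vectorMeasure (hi _) (hi _), integral_withDensityᵥ _ h₁' hf hC,
    integral_withDensityᵥ _ h₂' hf hC]

/-! ### Feature maps and reproducing kernel spaces. -/

section FeatureMap

lemma posSemidef_of_featureMap {X H : Type*} [NormedAddCommGroup H] [InnerProductSpace ℂ H]
    {Φ : X → H} {K : Matrix X X (ℂ →L[ℂ] ℂ)}
    (hK : ∀ x y, K x y = inner ℂ (Φ x) (Φ y) • ContinuousLinearMap.id ℂ ℂ) :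
    K.PosSemidef := by
  have htfae := (RKHS.posSemidef_tfae (K := K)).out 0 2
  refine htfae.mpr ⟨?_, fun v => ?_⟩
  · have hid : star (ContinuousLinearMap.id ℂ ℂ) = ContinuousLinearMap.id ℂ ℂ :=
      star_one (ℂ →L[ℂ] ℂ)
    ext x y
    simp [hK, Matrix.conjTranspose_apply, star_smul, hid]
  · have : (v.sum fun x w => v.sum fun x' w' => inner ℂ (K x' x w) w') =
        inner ℂ (v.sum fun x w => w • Φ x) (v.sum fun x w => w • Φ x) := by
      rw [Finsupp.sum_inner]
      refine Finsupp.sum_congr fun x _ => ?_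
      rw [Finsupp.inner_sum]
      refine Finsupp.sum_congr fun y _ => ?_
      simp [hK, inner_smul_right, inner_smul_left, mul_left_comm, mul_comm]
    rw [this]
    exact inner_self_nonneg

variable {X H₁ H₂ : Type*} [NormedAddCommGroup H₁] [InnerProductSpace ℂ H₁] [CompleteSpace H₁]
  [NormedAddCommGroup H₂] [InnerProductSpace ℂ H₂] [CompleteSpace H₂]

/-- Two feature maps with the same Gram matrix represent the same functions. -/
lemma exists_mem_closure_span_inner_eq {Φ₁ : X → H₁} {Φ₂ : X → H₂}
    (h : ∀ x y, inner ℂ (Φ₁ x) (Φ₁ y) = inner ℂ (Φ₂ x) (Φ₂ y)) (F : H₁) :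
    ∃ q ∈ (Submodule.span ℂ (Set.range Φ₂)).topologicalClosure,
      ∀ x, inner ℂ (Φ₁ x) F = inner ℂ (Φ₂ x) q := by
  set A := Finsupp.linearCombination ℂ Φ₁
  set B := Finsupp.linearCombination ℂ Φ₂
  have hAB : ∀ x c, inner ℂ (Φ₁ x) (A c) = inner ℂ (Φ₂ x) (B c) := fun x c => by
    simp [A, B, Finsupp.linearCombination_apply, Finsupp.inner_sum, inner_smul_right, h]
  have hABc : ∀ c d, inner ℂ (A c) (A d) = inner ℂ (B c) (B d) := fun c d => by
    have h1 : inner ℂ (A c) (A d) = c.sum fun x r => conj r * inner ℂ (Φ₁ x) (A d) := by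
      conv_lhs => rw [show A c = c.sum fun x r => r • Φ₁ x from
        Finsupp.linearCombination_apply ..]
      simp [Finsupp.sum_inner, inner_smul_left]
    have h2 : inner ℂ (B c) (B d) = c.sum fun x r => conj r * inner ℂ (Φ₂ x) (B d) := by
      conv_lhs => rw [show B c = c.sum fun x r => r • Φ₂ x from
        Finsupp.linearCombination_apply ..]
      simp [Finsupp.sum_inner, inner_smul_left]
    simp only [h1, h2, hAB]
  have hn : ∀ c, ‖A c‖ = ‖B c‖ := fun c => by
    rw [@norm_eq_sqrt_re_inner ℂ, hABc, ← @norm_eq_sqrt_re_inner ℂ]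
  -- By `hn`, `A c ↦ B c` is isometric. Projecting `F` to the closed span of `Φ₁` leaves its inner
  -- products with `Φ₁ x` unchanged, and the projection is a limit of vectors `A (c k)`; the
  -- corresponding `B (c k)` are then Cauchy and converge to `q`.
  set M := (Submodule.span ℂ (Set.range Φ₁)).topologicalClosure
  have : CompleteSpace M := (Submodule.isClosed_topologicalClosure _).completeSpace_coe
  set F' : H₁ := M.starProjection F
  have hF' : ∀ x, inner ℂ (Φ₁ x) F = inner ℂ (Φ₁ x) F' := fun x => by
    have hx : Φ₁ x ∈ M := Submodule.le_topologicalClosure _ (Submodule.subset_span ⟨x, rfl⟩)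
    have := Submodule.starProjection_inner_eq_zero (K := M) F (Φ₁ x) hx
    rw [← inner_conj_symm, map_eq_zero, inner_sub_right, sub_eq_zero] at this
    exact this
  have hmem : F' ∈ closure (Set.range A) := by
    have h1 : F' ∈ M := Submodule.starProjection_apply_mem M F
    have h2 : (Set.range A) = (Submodule.span ℂ (Set.range Φ₁) : Set H₁) := by
      rw [← Finsupp.range_linearCombination]; rfl
    rw [h2]
    exact h1
  obtain ⟨u, hu, hlim⟩ := mem_closure_iff_seq_limit.mp hmem
  choose c hc using hu
  have hB : CauchySeq fun k => B (c k) := by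
    have hA : CauchySeq fun k => A (c k) := by
      simpa only [hc] using hlim.cauchySeq
    rw [Metric.cauchySeq_iff] at hA ⊢
    simpa only [dist_eq_norm, ← map_sub, hn] using hA
  obtain ⟨q, hq⟩ := cauchySeq_tendsto_of_complete hB
  refine ⟨q, ?_, fun x => ?_⟩
  · refine (Submodule.isClosed_topologicalClosure _).mem_of_tendsto hq
      (Eventually.of_forall fun k => Submodule.le_topologicalClosure _ ?_)
    rw [← Finsupp.range_linearCombination]
    exact ⟨c k, rfl⟩
  · rw [hF']
    have h1 : Tendsto (fun k => inner ℂ (Φ₁ x) (A (c k))) atTop (𝓝 (inner ℂ (Φ₁ x) F')) := by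
      simp only [hc]
      exact tendsto_const_nhds.inner hlim
    have h2 : Tendsto (fun k => inner ℂ (Φ₂ x) (B (c k))) atTop (𝓝 (inner ℂ (Φ₂ x) q)) :=
      tendsto_const_nhds.inner hq
    simp only [hAB] at h1
    exact tendsto_nhds_unique h1 h2

/-- The kernel functions of the reproducing kernel space are themselves a feature map for `K`, so
they can be exchanged with `Φ` in either direction. -/
lemma exists_ofKernel_iff {Φ : X → H₁} {K : Matrix X X (ℂ →L[ℂ] ℂ)} [Fact K.PosSemidef]
    (hK : ∀ x y, K x y = inner ℂ (Φ x) (Φ y) • ContinuousLinearMap.id ℂ ℂ) {f : X → ℂ} :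
    (∃ F : RKHS.OfKernel K, ∀ x, F x = f x) ↔
      ∃ q ∈ (Submodule.span ℂ (Set.range Φ)).topologicalClosure, ∀ x, inner ℂ (Φ x) q = f x := by
  set Ψ : X → RKHS.OfKernel K := fun x => RKHS.kerFun (RKHS.OfKernel K) x 1
  have hev : ∀ (F : RKHS.OfKernel K) x, inner ℂ (Ψ x) F = F x := fun F x => by
    simp [Ψ, RKHS.kerFun_inner]
  have hG : ∀ x y, inner ℂ (Ψ x) (Ψ y) = inner ℂ (Φ x) (Φ y) := fun x y => by
    rw [hev, RKHS.kerFun_apply, RKHS.OfKernel.kernel_ofKernel, hK]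
    simp
  constructor
  · rintro ⟨F, hF⟩
    obtain ⟨q, hq, h⟩ := exists_mem_closure_span_inner_eq hG F
    exact ⟨q, hq, fun x => by rw [← h, hev, hF]⟩
  · rintro ⟨q, -, hq⟩
    obtain ⟨F, -, h⟩ := exists_mem_closure_span_inner_eq (fun x y => (hG x y).symm) q
    exact ⟨F, fun x => by rw [← hev, ← h, hq]⟩

end FeatureMap

/-! ### The polydisc, the torus and the Cauchy kernels. -/

variable {n : ℕ}

lemma polydisc_eq_ball (n : ℕ) : polydisc n = Metric.ball 0 1 := by
  ext z
  simp [polydisc, pi_norm_lt_iff]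

lemma isOpen_polydisc (n : ℕ) : IsOpen (polydisc n) :=
  polydisc_eq_ball n ▸ Metric.isOpen_ball

lemma convex_polydisc (n : ℕ) : Convex ℝ (polydisc n) :=
  polydisc_eq_ball n ▸ convex_ball 0 1

lemma star_mem_polydisc {z : Fin n → ℂ} (hz : z ∈ polydisc n) : star z ∈ polydisc n :=
  fun j => by simpa using hz j

lemma Torus.norm_toVec (ζ : Torus n) (j : Fin n) : ‖ζ.toVec j‖ = 1 := by
  simp [Torus.toVec]

lemma Torus.toVec_mem_closedPolydisc (ζ : Torus n) : ζ.toVec ∈ closedPolydisc n :=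
  fun j => (ζ.norm_toVec j).le

lemma Torus.continuous_toVec : Continuous (Torus.toVec (n := n)) := by
  unfold Torus.toVec
  fun_prop

lemma one_sub_mul_ne_zero {a b : ℂ} (ha : ‖a‖ ≤ 1) (hb : ‖b‖ < 1) : 1 - a * b ≠ 0 := by
  intro h
  have h1 : ‖a * b‖ = 1 := by rw [← sub_eq_zero.mp h, norm_one]
  rw [norm_mul] at h1
  nlinarith [norm_nonneg a, norm_nonneg b]

/-- The coordinate functions on the torus. -/
def coordMap (j : Fin n) : C(Torus n, ℂ) := ⟨fun ζ => ζ.toVec j, by unfold Torus.toVec; fun_prop⟩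

@[simp] lemma coordMap_apply (j : Fin n) (ζ : Torus n) : coordMap j ζ = ζ.toVec j := rfl

lemma norm_smul_coordMap_lt {c : ℂ} (hc : ‖c‖ < 1) (j : Fin n) : ‖c • coordMap j‖ < 1 := by
  rw [ContinuousMap.norm_lt_iff _ one_pos]
  intro ζ
  simpa [Torus.norm_toVec] using hc

/-- The function `ζ ↦ ∏ⱼ 1 / (1 - ζⱼ vⱼ)` on the torus; it depends holomorphically on `v`. -/
def cauchyMap (v : Fin n → ℂ) : C(Torus n, ℂ) := ∏ j, Ring.inverse (1 - v j • coordMap j)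

lemma inverse_one_sub_smul_coordMap_apply {c : ℂ} (hc : ‖c‖ < 1) (j : Fin n) (ζ : Torus n) :
    Ring.inverse (1 - c • coordMap j) ζ = 1 / (1 - ζ.toVec j * c) := by
  have hu := isUnit_one_sub_of_norm_lt_one (norm_smul_coordMap_lt hc j)
  have h1 := congrArg (fun f : C(Torus n, ℂ) => f ζ) (Ring.mul_inverse_cancel _ hu)
  simp only [ContinuousMap.mul_apply, ContinuousMap.one_apply, ContinuousMap.sub_apply,
    ContinuousMap.smul_apply, coordMap_apply, smul_eq_mul] at h1
  rw [mul_comm c] at h1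
  exact eq_one_div_of_mul_eq_one_right h1

lemma cauchyMap_apply {v : Fin n → ℂ} (hv : v ∈ polydisc n) (ζ : Torus n) :
    cauchyMap v ζ = cauchyKernel ζ.toVec (star v) := by
  simp [cauchyMap, cauchyKernel, ContinuousMap.prod_apply,
    inverse_one_sub_smul_coordMap_apply (hv _)]

lemma cauchyMap_star_apply {w : Fin n → ℂ} (hw : w ∈ polydisc n) (ζ : Torus n) :
    cauchyMap (star w) ζ = cauchyKernel ζ.toVec w := by
  rw [cauchyMap_apply (star_mem_polydisc hw), star_star]

lemma cauchyKernel_ne_zero {z w : Fin n → ℂ} (hz : z ∈ closedPolydisc n) (hw : w ∈ polydisc n) :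
    cauchyKernel z w ≠ 0 :=
  Finset.prod_ne_zero_iff.mpr fun j _ =>
    one_div_ne_zero (one_sub_mul_ne_zero (hz j) (by simpa using hw j))

/-- Holomorphy here is in the sup norm, because inversion in the Banach algebra `C(Torus n, ℂ)` is
differentiable at units. Hence continuous functionals of `cauchyMap v` are holomorphic in `v`. -/
lemma differentiableOn_cauchyMap : DifferentiableOn ℂ (cauchyMap (n := n)) (polydisc n) := by
  intro v hv
  refine DifferentiableAt.differentiableWithinAt <|
    HasFDerivAt.differentiableAt <| (HasFDerivAt.finsetProd (u := Finset.univ)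
      (g := fun j (v : Fin n → ℂ) => Ring.inverse (1 - v j • coordMap (n := n) j)) fun j _ => DifferentiableAt.hasFDerivAt ?_)
  have h1 : DifferentiableAt ℂ (fun v : Fin n → ℂ => 1 - v j • coordMap (n := n) j) v := by
    fun_prop
  exact (differentiableAt_inverse
    (isUnit_one_sub_of_norm_lt_one (norm_smul_coordMap_lt (hv j) j))).comp v h1

lemma cauchyKernel_mem_polydiscAlgebra {w : Fin n → ℂ} (hw : w ∈ polydisc n) :
    (fun z => cauchyKernel z w) ∈ polydiscAlgebra n := by
  have hne : ∀ z ∈ closedPolydisc n, ∀ j, 1 - z j * conj (w j) ≠ 0 := fun z hz j =>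
    one_sub_mul_ne_zero (hz j) (by simpa using hw j)
  constructor
  · unfold cauchyKernel
    refine continuousOn_finsetProd _ fun j _ => ?_
    exact ContinuousOn.div (by fun_prop) (by fun_prop) fun z hz => hne z hz j
  · intro z hz
    refine DifferentiableAt.differentiableWithinAt <|
      HasFDerivAt.differentiableAt <| (HasFDerivAt.finsetProd (u := Finset.univ)
        (g := fun j (z : Fin n → ℂ) => 1 / (1 - z j * conj (w j))) fun j _ => DifferentiableAt.hasFDerivAt ?_)
    have h1 : DifferentiableAt ℂ (fun z : Fin n → ℂ => 1 - z j * conj (w j)) z := by fun_prop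
    simpa only [one_div] using! h1.fun_inv (hne z (fun j => (hz j).le) j)

/-! ### Uniqueness from the antidiagonal. -/

/-- Functions of `(z, v)` holomorphic on `𝔻ⁿ × 𝔻ⁿ` are determined by their values at
`v = conj z`. -/
lemma eq_zero_of_antidiagonal {G : (Fin n → ℂ) × (Fin n → ℂ) → ℂ}
    (hG : DifferentiableOn ℂ G (polydisc n ×ˢ polydisc n))
    (h0 : ∀ z ∈ polydisc n, G (z, star z) = 0) {z v : Fin n → ℂ} (hz : z ∈ polydisc n)
    (hv : v ∈ polydisc n) : G (z, v) = 0 := by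
  -- With these choices the complex line `ℓ` hits `(z, v)` at `t = I`, while for real `t` its two
  -- components are conjugate to each other, so `G` vanishes there. The one-variable identity
  -- theorem on the convex set `U`, which contains `0` and `I`, carries the zero from the real
  -- points near `0` to `I`.
  set a : Fin n → ℂ := (1 / 2 : ℝ) • z + (1 / 2 : ℝ) • star v with ha
  set d : Fin n → ℂ := (-Complex.I / 2) • (z - star v) with hd
  have haD : a ∈ polydisc n :=
    convex_polydisc n hz (star_mem_polydisc hv) (by norm_num) (by norm_num) (by norm_num)
  set ℓ : ℂ → (Fin n → ℂ) × (Fin n → ℂ) := fun t => (a + t • d, star a + t • star d) with hℓ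
  have hℓd : Differentiable ℂ ℓ := by fun_prop
  have hℓI : ℓ Complex.I = (z, v) := by
    ext j
    · simp [hℓ, ha, hd]
      linear_combination (-(z j - conj (v j)) / 2) * Complex.I_sq
    · simp [hℓ, ha, hd]
      linear_combination ((conj (z j) - v j) / 2) * Complex.I_sq
  set U : Set ℂ := ℓ ⁻¹' (polydisc n ×ˢ polydisc n) with hU
  have hUo : IsOpen U :=
    ((isOpen_polydisc n).prod (isOpen_polydisc n)).preimage hℓd.continuous
  have hUc : Convex ℝ U := by
    intro s hs t ht p q hp hq hpq
    have : ℓ (p • s + q • t) = p • ℓ s + q • ℓ t := by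
      have hpq' : (p : ℂ) + q = 1 := by exact_mod_cast hpq
      ext j
      · simp [hℓ]
        linear_combination (-a j) * hpq'
      · simp [hℓ]
        linear_combination (-conj (a j)) * hpq'
    rw [hU, Set.mem_preimage, this]
    exact ((convex_polydisc n).prod (convex_polydisc n)) hs ht hp hq hpq
  have h0U : (0 : ℂ) ∈ U := by
    refine ⟨?_, ?_⟩
    · simpa [hℓ] using haD
    · simpa [hℓ] using star_mem_polydisc haD
  have hIU : Complex.I ∈ U := by
    rw [hU, Set.mem_preimage, hℓI]; exact ⟨hz, hv⟩
  have hg : AnalyticOnNhd ℂ (G ∘ ℓ) U :=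
    (hG.comp hℓd.differentiableOn fun t ht => ht).analyticOnNhd hUo
  have hfreq : ∃ᶠ t in 𝓝[≠] (0 : ℂ), (G ∘ ℓ) t = 0 := by
    have hreal : ∀ t : ℝ, (t : ℂ) ∈ U → (G ∘ ℓ) t = 0 := fun t ht => by
      have : star a + (t : ℂ) • star d = star (a + (t : ℂ) • d) := by
        ext j; simp
      simp only [Function.comp, hℓ, this]
      exact h0 _ ht.1
    have ht : Tendsto (fun t : ℝ => (t : ℂ)) (𝓝[≠] 0) (𝓝[≠] (0 : ℂ)) := by
      refine tendsto_nhdsWithin_iff.mpr ⟨?_, ?_⟩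
      · exact (Complex.continuous_ofReal.tendsto' 0 0 (by simp)).mono_left nhdsWithin_le_nhds
      · filter_upwards [self_mem_nhdsWithin] with t ht
        simpa using ht
    refine ht.frequently (Eventually.frequently ?_)
    have : ∀ᶠ t : ℝ in 𝓝[≠] 0, (t : ℂ) ∈ U :=
      ht.eventually (mem_nhdsWithin_of_mem_nhds (hUo.mem_nhds h0U))
    filter_upwards [this] with t ht using hreal t ht
  have := hg.eqOn_zero_of_preconnected_of_frequently_eq_zero hUc.isPreconnected h0U hfreq hIU
  simpa [hℓI] using this

/-! ### Functionals on `C(Torus n, ℂ)` and approximation by Cauchy kernels. -/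

/-- Integration of continuous functions against an integrable density. -/
def integralMulCLM (σ : Measure (Torus n)) {h : Torus n → ℂ} (hh : Integrable h σ) :
    C(Torus n, ℂ) →L[ℂ] ℂ :=
  have hi : ∀ f : C(Torus n, ℂ), Integrable (fun ζ => f ζ * h ζ) σ := fun f =>
    hh.bdd_mul f.continuous.aestronglyMeasurable (ae_of_all _ f.norm_coe_le_norm)
  LinearMap.mkContinuous
    { toFun := fun f => ∫ ζ, f ζ * h ζ ∂σ
      map_add' := fun f g => by
        simp only [ContinuousMap.add_apply, add_mul]
        exact integral_add (hi f) (hi g)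
      map_smul' := fun c f => by
        simp only [ContinuousMap.smul_apply, smul_eq_mul, mul_assoc, RingHom.id_apply]
        exact integral_const_mul c _ }
    (∫ ζ, ‖h ζ‖ ∂σ) fun f => by
      rw [mul_comm, ← integral_const_mul]
      refine norm_integral_le_of_norm_le (hh.norm.const_mul _) (ae_of_all _ fun ζ => ?_)
      rw [norm_mul]
      gcongr
      exact f.norm_coe_le_norm ζ

@[simp] lemma integralMulCLM_apply (σ : Measure (Torus n)) {h : Torus n → ℂ}
    (hh : Integrable h σ) (f : C(Torus n, ℂ)) :
    integralMulCLM σ hh f = ∫ ζ, f ζ * h ζ ∂σ := rfl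

/-- Each factor is a uniformly convergent geometric series in a coordinate. The uniform closure of
the polynomials is an algebra, so it contains the product, and uniform convergence implies `L²`
convergence. -/
lemma cauchyMap_mem_hardySpace (σ : Measure (Torus n)) [IsFiniteMeasure σ] {v : Fin n → ℂ}
    (hv : v ∈ polydisc n) : ContinuousMap.toLp 2 σ ℂ (cauchyMap v) ∈ hardySpace σ := by
  set A : Subalgebra ℂ C(Torus n, ℂ) := (MvPolynomial.aeval (coordMap (n := n))).range
  have hA : ∀ f ∈ A, ContinuousMap.toLp 2 σ ℂ f ∈ hardySpace σ := by
    rintro f ⟨p, rfl⟩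
    refine Submodule.le_topologicalClosure _ (Submodule.subset_span ⟨p, ?_⟩)
    refine (ContinuousMap.coeFn_toLp σ _).trans (ae_of_all _ fun ζ => ?_)
    have : (ContinuousMap.evalAlgHom ℂ ℂ ζ).comp (MvPolynomial.aeval (coordMap (n := n))) =
        MvPolynomial.aeval ζ.toVec := by
      ext j; simp
    have := DFunLike.congr_fun this p
    simpa [MvPolynomial.coe_aeval_eq_eval] using this
  have hAc : ∀ f ∈ A.topologicalClosure, ContinuousMap.toLp 2 σ ℂ f ∈ hardySpace σ := by
    intro f hf
    have hcl : IsClosed {f : C(Torus n, ℂ) | ContinuousMap.toLp 2 σ ℂ f ∈ hardySpace σ} :=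
      (Submodule.isClosed_topologicalClosure _).preimage (ContinuousLinearMap.continuous _)
    exact closure_minimal (fun f hf => hA f hf) hcl hf
  refine hAc _ (prod_mem fun j _ => ?_)
  have hlt := norm_smul_coordMap_lt (hv j) j
  have hs : HasSum (fun k : ℕ => (v j • coordMap (n := n) j) ^ k)
      (Ring.inverse (1 - v j • coordMap j)) := by
    rw [NormedRing.inverse_one_sub _ hlt]
    exact (summable_geometric_of_norm_lt_one hlt).hasSum
  refine A.isClosed_topologicalClosure.mem_of_tendsto hs (Eventually.of_forall fun s => ?_)
  refine sum_mem fun k _ => pow_mem (Subalgebra.smul_mem _ ?_ _) _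
  exact A.le_topologicalClosure ⟨MvPolynomial.X j, by simp⟩

lemma continuous_comp_toVec {f : (Fin n → ℂ) → ℂ} (hf : f ∈ polydiscAlgebra n) :
    Continuous fun ζ : Torus n => f ζ.toVec :=
  hf.1.comp_continuous Torus.continuous_toVec Torus.toVec_mem_closedPolydisc

/-- The one-variable Cauchy formula, as an average over the circle. -/
lemma average_circle_cauchy {h : ℂ → ℂ} (hh : DifferentiableOn ℂ h (Metric.closedBall 0 1))
    {w : ℂ} (hw : ‖w‖ < 1) :
    (2 * Real.pi : ℂ)⁻¹ * ∫ θ in (0 : ℝ)..2 * Real.pi,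
      h (circleMap 0 1 θ) * (1 / (1 - w * conj (circleMap 0 1 θ))) = h w := by
  have hd : DiffContOnCl ℂ h (Metric.ball 0 1) := by
    refine DifferentiableOn.diffContOnCl ?_
    rwa [closure_ball _ one_ne_zero]
  have h1 := hd.two_pi_i_inv_smul_circleIntegral_sub_inv_smul (w := w) (by simpa using hw)
  rw [← h1, circleIntegral]
  simp only [smul_eq_mul, deriv_circleMap]
  -- On the unit circle `conj s = s⁻¹`, which turns `ds / (s - w)` into `I dθ / (1 - w * conj s)`.
  have : ∀ θ : ℝ, circleMap 0 1 θ * Complex.I * ((circleMap 0 1 θ - w)⁻¹ * h (circleMap 0 1 θ)) =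
      Complex.I * (h (circleMap 0 1 θ) * (1 / (1 - w * conj (circleMap 0 1 θ)))) := fun θ => by
    set s := circleMap 0 1 θ
    have hs : s * conj s = 1 := by
      rw [Complex.mul_conj']
      simp [s]
    have hs1 : ‖conj s‖ ≤ 1 := by simp [s]
    have hs0 : s ≠ 0 := left_ne_zero_of_mul_eq_one hs
    have h2 : 1 - w * conj s ≠ 0 := by
      rw [mul_comm]; exact one_sub_mul_ne_zero hs1 hw
    have h3 : s - w = s * (1 - w * conj s) := by linear_combination (w) * hs
    rw [h3]
    field_simp
  simp only [this]
  rw [intervalIntegral.integral_const_mul]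
  have := Complex.I_ne_zero
  field_simp

/-- A functional on `C(𝕋ⁿ)` that kills the Cauchy kernels kills the dilated functions
`ζ ↦ f (r² ζ)`; here `f` is dilated in the coordinates of `S`, and the Cauchy kernel is still present
in the others. -/
lemma map_eq_zero_of_partial_dilation (L : C(Torus n, ℂ) →L[ℂ] ℂ)
    (hL : ∀ v ∈ polydisc n, L (cauchyMap v) = 0) {f : (Fin n → ℂ) → ℂ}
    (hf : DifferentiableOn ℂ f (polydisc n)) {r : ℝ} (hr0 : 0 < r) (hr1 : r < 1)
    (S : Finset (Fin n)) : ∀ η : Fin n → ℂ, (∀ j, ‖η j‖ ≤ 1) → ∀ g : C(Torus n, ℂ),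
      (∀ ζ, g ζ = f (fun j => if j ∈ S then r ^ 2 * ζ.toVec j else r * η j) *
        ∏ j ∈ Sᶜ, 1 / (1 - ζ.toVec j * (r * conj (η j)))) → L g = 0 := by
  have hrη : ∀ {c : ℂ}, ‖c‖ ≤ 1 → ‖(r : ℂ) * c‖ < 1 := fun {c} hc => by
    rw [norm_mul, Complex.norm_real, Real.norm_of_nonneg hr0.le]
    nlinarith [norm_nonneg c]
  have hrζ : ∀ (ζ : Torus n) (j : Fin n), ‖(r : ℂ) ^ 2 * ζ.toVec j‖ < 1 := fun ζ j => by
    rw [pow_two, mul_assoc]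
    exact hrη (hrη (ζ.norm_toVec j).le).le
  induction S using Finset.induction_on with
  | empty =>
    intro η hη g hg
    have hv : (fun j => (r : ℂ) * conj (η j)) ∈ polydisc n := fun j => hrη (by simpa using hη j)
    have : g = f (fun j => r * η j) • cauchyMap fun j => (r : ℂ) * conj (η j) := by
      ext ζ
      simp [hg, cauchyMap_apply hv, cauchyKernel]
    rw [this, map_smul, hL _ hv, smul_zero]
  | insert j S hj ih =>
    intro η hη g hg
    -- The `j`-th parameter is freed to a variable `s` on the circle. Averaging against `1 / (1 - r
    -- ζⱼ conj s)` evaluates at `s = r ζⱼ`, so the argument `r s` of `f` becomes `r² ζⱼ`: one factor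
    -- `r` comes from `f`, the other from the kernel.
    set p : Torus n → ℂ → Fin n → ℂ := fun ζ s i =>
      if i ∈ S then (r : ℂ) ^ 2 * ζ.toVec i else r * Function.update η j s i with hp
    have hpD : ∀ ζ s, ‖s‖ ≤ 1 → p ζ s ∈ polydisc n := fun ζ s hs i => by
      simp only [hp]
      split_ifs
      · exact hrζ ζ i
      · refine hrη ?_
        by_cases hi : i = j
        · subst hi; simpa using hs
        · simpa [hi] using hη i
    set P : Torus n → ℂ := fun ζ => ∏ i ∈ (insert j S)ᶜ, 1 / (1 - ζ.toVec i * (r * conj (η i)))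
      with hP
    have hcirc : ∀ θ : ℝ, ‖circleMap 0 1 θ‖ ≤ 1 := fun θ => by simp
    set F₀ : ℝ × Torus n → ℂ := fun x => f (p x.2 (circleMap 0 1 x.1)) *
      (1 / (1 - x.2.toVec j * (r * conj (circleMap 0 1 x.1))) * P x.2) with hF₀
    have htoVec : ∀ i, Continuous fun ζ : Torus n => ζ.toVec i := fun i =>
      (continuous_apply i).comp Torus.continuous_toVec
    have hcm : Continuous (circleMap 0 1) := continuous_circleMap 0 1
    have hF₀c : Continuous F₀ := by
      refine Continuous.mul ?_ (Continuous.mul ?_ ?_)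
      · refine hf.continuousOn.comp_continuous ?_ fun x => hpD _ _ (hcirc _)
        refine continuous_pi fun i => ?_
        simp only [hp]
        split_ifs
        · exact continuous_const.mul ((htoVec i).comp continuous_snd)
        · by_cases hi : i = j
          · subst hi
            simp only [Function.update_self]
            exact continuous_const.mul (hcm.comp continuous_fst)
          · simpa [hi] using continuous_const
      · refine Continuous.div continuous_const ?_ fun x =>
          one_sub_mul_ne_zero (x.2.norm_toVec j).le (hrη (by simp))
        exact continuous_const.sub (((htoVec j).comp continuous_snd).mul
          (continuous_const.mul (Complex.continuous_conj.comp (hcm.comp continuous_fst))))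
      · refine Continuous.comp (g := P) ?_ continuous_snd
        refine continuous_finsetProd _ fun i _ => ?_
        refine Continuous.div continuous_const ?_ fun ζ =>
          one_sub_mul_ne_zero (ζ.norm_toVec i).le (hrη (by simpa using hη i))
        exact continuous_const.sub ((htoVec i).mul continuous_const)
    -- Viewing the integrand as a curve in `C(Torus n, ℂ)` lets `L` pass under the integral, where
    -- the induction hypothesis applies for each `θ`.
    set F : C(ℝ, C(Torus n, ℂ)) := ContinuousMap.curry ⟨F₀, hF₀c⟩
    have hLF : ∀ θ, L (F θ) = 0 := fun θ => by
      refine ih (Function.update η j (circleMap 0 1 θ)) (fun i => ?_) _ fun ζ => ?_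
      · by_cases hi : i = j
        · subst hi; simp
        · simpa [hi] using hη i
      · have hS : Sᶜ = insert j (insert j S)ᶜ := by
          ext i; by_cases hi : i = j <;> simp [hi, hj]
        rw [hS, Finset.prod_insert (by simp)]
        have : ∏ i ∈ (insert j S)ᶜ, 1 / (1 - ζ.toVec i *
            (r * conj (Function.update η j (circleMap 0 1 θ) i))) = P ζ := by
          refine Finset.prod_congr rfl fun i hi => ?_
          have : i ≠ j := by rintro rfl; simp at hi
          simp [this]
        rw [this]
        simp [F, hF₀, hp]
    have hFint : IntervalIntegrable F volume 0 (2 * Real.pi) :=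
      F.continuous.intervalIntegrable _ _
    have hgF : g = (2 * Real.pi : ℂ)⁻¹ • ∫ θ in (0 : ℝ)..2 * Real.pi, F θ := by
      ext ζ
      have h1 := (ContinuousMap.evalCLM ℂ ζ).intervalIntegral_comp_comm hFint
      simp only [ContinuousMap.evalCLM_apply] at h1
      rw [ContinuousMap.smul_apply, ← h1, hg]
      set h : ℂ → ℂ := fun s => f (p ζ s) with hh
      have hhd : DifferentiableOn ℂ h (Metric.closedBall 0 1) := by
        intro s hs
        have hs' : ‖s‖ ≤ 1 := by simpa using hs
        refine DifferentiableAt.differentiableWithinAt ?_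
        refine DifferentiableAt.comp s
          (hf.differentiableAt ((isOpen_polydisc n).mem_nhds (hpD ζ s hs'))) ?_
        refine differentiableAt_pi.mpr fun i => ?_
        simp only [hp]
        split_ifs
        · fun_prop
        · by_cases hi : i = j
          · subst hi
            simp only [Function.update_self]
            fun_prop
          · simp [hi]
      have hw := hrη (ζ.norm_toVec j).le
      have h2 := average_circle_cauchy hhd hw
      have h3 : p ζ (r * ζ.toVec j) =
          fun i => if i ∈ insert j S then (r : ℂ) ^ 2 * ζ.toVec i else r * η i := by
        ext i
        by_cases hi : i = j
        · subst hi
          simp [hp, hj]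
          ring
        · simp [hp, hi]
      rw [← h3, smul_eq_mul]
      change h (r * ζ.toVec j) * P ζ = _
      rw [← h2, mul_assoc, ← intervalIntegral.integral_mul_const]
      congr 2
      ext θ
      simp only [F, ContinuousMap.curry_apply, ContinuousMap.coe_mk, hF₀, hh]
      rw [mul_assoc]
      congr 4
      ring
    rw [hgF, map_smul, ← L.intervalIntegral_comp_comm hFint]
    simp [hLF]

/-- A functional on `C(𝕋ⁿ)` that kills the Cauchy kernels kills the polydisc algebra. -/
lemma map_polydiscAlgebra_eq_zero (L : C(Torus n, ℂ) →L[ℂ] ℂ)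
    (hL : ∀ v ∈ polydisc n, L (cauchyMap v) = 0) {f : (Fin n → ℂ) → ℂ}
    (hf : f ∈ polydiscAlgebra n) : L ⟨fun ζ => f ζ.toVec, continuous_comp_toVec hf⟩ = 0 := by
  have hc : Continuous fun x : unitInterval × Torus n =>
      f (fun j => ((x.1 : ℝ) : ℂ) ^ 2 * x.2.toVec j) := by
    refine hf.1.comp_continuous ?_ fun x j => ?_
    · refine continuous_pi fun j => ?_
      have := (continuous_apply j).comp (Torus.continuous_toVec (n := n))
      exact ((Complex.continuous_ofReal.comp (continuous_subtype_val.comp continuous_fst)).pow 2).mul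
        (this.comp continuous_snd)
    · have h0 := x.1.2.1
      have h1 := x.1.2.2
      rw [norm_mul, Torus.norm_toVec, mul_one, norm_pow, Complex.norm_real,
        Real.norm_of_nonneg h0]
      exact pow_le_one₀ h0 h1
  -- The dilations `f (t² ζ)` depend continuously on `t` in the sup norm, up to `t = 1`, so the
  -- vanishing of `L` for `0 < t < 1` extends to `f` itself.
  set γ : C(unitInterval, C(Torus n, ℂ)) := ContinuousMap.curry ⟨_, hc⟩
  have hγ : ∀ t : unitInterval, t ∈ Set.Ioo (0 : unitInterval) 1 → L (γ t) = 0 := fun t ht => by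
    refine map_eq_zero_of_partial_dilation L hL hf.2 (r := t) ht.1 ht.2 Finset.univ 0
      (by simp) _ fun ζ => ?_
    simp [γ]
  have hcl : IsClosed {t : unitInterval | L (γ t) = 0} :=
    isClosed_eq (L.continuous.comp γ.continuous) continuous_const
  have h1 : (1 : unitInterval) ∈ closure (Set.Ioo (0 : unitInterval) 1) := by
    rw [closure_Ioo zero_ne_one]
    simp
  have h2 : L (γ 1) = 0 := closure_minimal hγ hcl h1
  convert h2 using 2
  ext ζ
  simp [γ]

/-! ### Clark measures and the description of `H(b)`. -/

/-- On the torus `|1 - ζⱼ conj zⱼ| = |ζⱼ - zⱼ|`. This makes the Poisson identity a statement about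
the diagonal of the Gram matrix of the Cauchy kernels. -/
lemma normSq_cauchyKernel_torus {z : Fin n → ℂ} (hz : z ∈ polydisc n) (ζ : Torus n) :
    conj (cauchyKernel ζ.toVec z) * cauchyKernel ζ.toVec z =
      polydiscPoissonKernel z ζ.toVec * cauchyKernel z z := by
  simp only [cauchyKernel, polydiscPoissonKernel, map_prod, Complex.ofReal_prod,
    ← Finset.prod_mul_distrib]
  refine Finset.prod_congr rfl fun j _ => ?_
  have hζ := ζ.norm_toVec j
  set x := ζ.toVec j
  have hx : x * conj x = 1 := by rw [Complex.mul_conj']; simp [hζ]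
  have hx0 : x ≠ 0 := left_ne_zero_of_mul_eq_one hx
  have h1 : 1 - x * conj (z j) ≠ 0 :=
    one_sub_mul_ne_zero (ζ.norm_toVec j).le (by simpa using hz j)
  have h2 : 1 - conj x * z j ≠ 0 := one_sub_mul_ne_zero (by simp [hζ]) (hz j)
  have h3 : 1 - z j * conj (z j) ≠ 0 := one_sub_mul_ne_zero (hz j).le (by simpa using hz j)
  have h4 : (‖x - z j‖ : ℂ) ^ 2 = (1 - conj x * z j) * (1 - x * conj (z j)) := by
    rw [← Complex.mul_conj', map_sub]
    linear_combination (1 - z j * conj (z j)) * hx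
  have h5 : (‖z j‖ : ℂ) ^ 2 = z j * conj (z j) := (Complex.mul_conj' _).symm
  push_cast
  rw [h4, h5]
  simp only [map_div₀, map_one, map_sub, map_mul, Complex.conj_conj]
  field_simp

lemma one_sub_conj_mul_ne_zero {α x : ℂ} (hα : ‖α‖ = 1) (hx : ‖x‖ < 1) : 1 - conj α * x ≠ 0 :=
  one_sub_mul_ne_zero (by simp [hα]) hx

/-- The Poisson identity defining the Clark measure, polarized: the Gram matrix of the Cauchy
kernels in `L²(σ_α[b])`. -/
lemma IsClarkMeasure.integral_cauchyKernel {α : ℂ} (hα : ‖α‖ = 1) {b : (Fin n → ℂ) → ℂ}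
    (hb : IsNonconstantSelfMap b) {σ : Measure (Torus n)} (hσ : IsClarkMeasure α b σ)
    {z w : Fin n → ℂ} (hz : z ∈ polydisc n) (hw : w ∈ polydisc n) :
    (∫ ζ, conj (cauchyKernel ζ.toVec z) * cauchyKernel ζ.toVec w ∂σ) *
      ((1 - conj α * b z) * (1 - α * conj (b w))) = dbrKernel b z w := by
  have := hσ.isFiniteMeasure
  set L := integralMulCLM σ (integrable_const (1 : ℂ))
  have hL : ∀ {z w}, z ∈ polydisc n → w ∈ polydisc n →
      L (star (cauchyMap (star z)) * cauchyMap (star w)) =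
        ∫ ζ, conj (cauchyKernel ζ.toVec z) * cauchyKernel ζ.toVec w ∂σ := fun hz hw => by
    simp [L, cauchyMap_star_apply hz, cauchyMap_star_apply hw]
  -- Difference of the two sides with `conj w` replaced by an independent variable. Each `star ∘ · ∘
  -- star` turns antiholomorphic dependence into holomorphic dependence, and the Poisson identity
  -- gives `G (z, star z) = 0`.
  set G : (Fin n → ℂ) × (Fin n → ℂ) → ℂ := fun p =>
    L ((star ∘ cauchyMap ∘ star) p.1 * cauchyMap p.2) *
      ((1 - conj α * b p.1) * (1 - α * (star ∘ b ∘ star) p.2)) -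
    (1 - b p.1 * (star ∘ b ∘ star) p.2) * ∏ j, (1 - p.1 j * p.2 j)⁻¹ with hG
  have hGd : DifferentiableOn ℂ G (polydisc n ×ˢ polydisc n) := by
    rintro ⟨z, v⟩ ⟨hz, hv⟩
    refine DifferentiableAt.differentiableWithinAt ?_
    have hat : ∀ {F : Type} [NormedAddCommGroup F] [NormedSpace ℂ F] {g : (Fin n → ℂ) → F}
        {z}, DifferentiableOn ℂ g (polydisc n) → z ∈ polydisc n → DifferentiableAt ℂ g z :=
      fun hg hz => hg.differentiableAt ((isOpen_polydisc n).mem_nhds hz)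
    have hfst : DifferentiableAt ℂ (fun p : (Fin n → ℂ) × (Fin n → ℂ) => p.1) (z, v) := by
      fun_prop
    have hsnd : DifferentiableAt ℂ (fun p : (Fin n → ℂ) × (Fin n → ℂ) => p.2) (z, v) := by
      fun_prop
    have h1 : DifferentiableAt ℂ (fun p : (Fin n → ℂ) × (Fin n → ℂ) =>
        (star ∘ cauchyMap ∘ star) p.1) (z, v) := by
      have := (hat differentiableOn_cauchyMap (star_mem_polydisc hz)).star_star
      rw [star_star] at this
      exact DifferentiableAt.comp (z, v) (g := star ∘ cauchyMap ∘ star) this hfst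
    have h2 : DifferentiableAt ℂ (fun p : (Fin n → ℂ) × (Fin n → ℂ) => cauchyMap p.2) (z, v) :=
      DifferentiableAt.comp (z, v) (g := cauchyMap) (hat differentiableOn_cauchyMap hv) hsnd
    have h3 : DifferentiableAt ℂ (fun p : (Fin n → ℂ) × (Fin n → ℂ) => b p.1) (z, v) :=
      DifferentiableAt.comp (z, v) (g := b) (hat hb.differentiableOn hz) hfst
    have h4 : DifferentiableAt ℂ (fun p : (Fin n → ℂ) × (Fin n → ℂ) =>
        (star ∘ b ∘ star) p.2) (z, v) := by
      have := (hat hb.differentiableOn (star_mem_polydisc hv)).star_star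
      rw [star_star] at this
      exact DifferentiableAt.comp (z, v) (g := star ∘ b ∘ star) this hsnd
    have h5 : DifferentiableAt ℂ (fun p : (Fin n → ℂ) × (Fin n → ℂ) =>
        ∏ j, (1 - p.1 j * p.2 j)⁻¹) (z, v) := by
      refine HasFDerivAt.differentiableAt <| HasFDerivAt.finsetProd (u := Finset.univ)
        (g := fun j (p : (Fin n → ℂ) × (Fin n → ℂ)) => (1 - p.1 j * p.2 j)⁻¹)
        fun j _ => DifferentiableAt.hasFDerivAt ?_
      have : DifferentiableAt ℂ
          (fun p : (Fin n → ℂ) × (Fin n → ℂ) => 1 - p.1 j * p.2 j) (z, v) := by fun_prop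
      exact this.fun_inv (one_sub_mul_ne_zero (hz j).le (hv j))
    have h6 := L.differentiableAt.comp (z, v) (h1.mul h2)
    have h7 := (h3.const_mul (conj α)).const_sub 1
    have h8 := (h4.const_mul α).const_sub 1
    exact (h6.mul (h7.mul h8)).sub (((h3.mul h4).const_sub 1).mul h5)
  have hG0 : ∀ z ∈ polydisc n, G (z, star z) = 0 := fun z hz => by
    simp only [hG, Function.comp, star_star]
    rw [hL hz hz]
    simp_rw [normSq_cauchyKernel_torus hz]
    rw [integral_mul_const, integral_complex_ofReal, hσ.poisson_eq z hz]
    have hbz := hb.mapsTo z hz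
    have h1 := one_sub_conj_mul_ne_zero hα hbz
    have h2 : 1 - α * conj (b z) ≠ 0 := one_sub_mul_ne_zero hα.le (by simpa using hbz)
    have hαα : α * conj α = 1 := by rw [Complex.mul_conj']; simp [hα]
    have h3 : (‖α - b z‖ : ℂ) ^ 2 = (1 - conj α * b z) * (1 - α * conj (b z)) := by
      rw [← Complex.mul_conj', map_sub]
      linear_combination (1 - b z * conj (b z)) * hαα
    have h4 : (‖b z‖ : ℂ) ^ 2 = b z * conj (b z) := (Complex.mul_conj' _).symm
    push_cast
    rw [h3, h4]
    simp only [cauchyKernel, one_div, Pi.star_apply, RCLike.star_def]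
    rw [div_mul_eq_mul_div, div_mul_cancel₀ _ (mul_ne_zero h1 h2), sub_self]
  have := eq_zero_of_antidiagonal hGd hG0 hz (star_mem_polydisc hw)
  simp only [hG, Function.comp, star_star, sub_eq_zero] at this
  rw [hL hz hw] at this
  simpa [dbrKernel, cauchyKernel] using this

/-- `Φ` is a feature map for `k_b` with values in `H²(σ)`; pairing `q` with `Φ z` produces the
stated weighted Cauchy integral. -/
lemma IsClarkMeasure.mem_deBrangesRovnyak_iff {α : ℂ} (hα : ‖α‖ = 1) {b : (Fin n → ℂ) → ℂ}
    (hb : IsNonconstantSelfMap b) {σ : Measure (Torus n)} (hσ : IsClarkMeasure α b σ)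
    {f : polydisc n → ℂ} :
    f ∈ deBrangesRovnyak b ↔ ∃ q ∈ hardySpace σ, ∀ z : polydisc n,
      (1 - conj α * b z) * ∫ ζ, conj (cauchyKernel ζ.toVec z) * q ζ ∂σ = f z := by
  have := hσ.isFiniteMeasure
  set Φ : polydisc n → Lp ℂ 2 σ := fun z =>
    (1 - α * conj (b z)) • ContinuousMap.toLp 2 σ ℂ (cauchyMap (star z.1)) with hΦ
  have hΦH : ∀ z, Φ z ∈ hardySpace σ := fun z =>
    Submodule.smul_mem _ _ (cauchyMap_mem_hardySpace σ (star_mem_polydisc z.2))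
  have hin : ∀ z (q : Lp ℂ 2 σ), inner ℂ (Φ z) q =
      (1 - conj α * b z) * ∫ ζ, conj (cauchyKernel ζ.toVec z) * q ζ ∂σ := fun z q => by
    rw [hΦ, inner_smul_left, L2.inner_def]
    congr 1
    · simp
    · refine integral_congr_ae ?_
      filter_upwards [ContinuousMap.coeFn_toLp (p := 2) (𝕜 := ℂ) σ (cauchyMap (star z.1))]
        with ζ hζ
      rw [hζ, cauchyMap_star_apply z.2, RCLike.inner_apply, mul_comm]
  have hK : ∀ z w, dbrMatrix b z w = inner ℂ (Φ z) (Φ w) • ContinuousLinearMap.id ℂ ℂ :=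
    fun z w => by
    have h1 : ∫ ζ, conj (cauchyKernel ζ.toVec z) * Φ w ζ ∂σ = (1 - α * conj (b w)) *
        ∫ ζ, conj (cauchyKernel ζ.toVec z) * cauchyKernel ζ.toVec w ∂σ := by
      rw [← integral_const_mul]
      refine integral_congr_ae ?_
      filter_upwards [ContinuousMap.coeFn_toLp (p := 2) (𝕜 := ℂ) σ (cauchyMap (star w.1)),
        Lp.coeFn_smul (1 - α * conj (b w)) (ContinuousMap.toLp 2 σ ℂ (cauchyMap (star w.1)))]
        with ζ hζ hζ'
      rw [hΦ, hζ', Pi.smul_apply, hζ, cauchyMap_star_apply w.2, smul_eq_mul]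
      ring
    rw [hin, h1]
    simp only [dbrMatrix, Matrix.of_apply]
    rw [← hσ.integral_cauchyKernel hα hb z.2 w.2]
    congr 1
    ring
  have hpos := posSemidef_of_featureMap hK
  have : Fact (dbrMatrix b).PosSemidef := ⟨hpos⟩
  have key := exists_ofKernel_iff hK (f := f)
  constructor
  · rintro ⟨_, hF⟩
    obtain ⟨q, hq, h⟩ := key.mp hF
    refine ⟨q, ?_, fun z => by rw [← hin, h]⟩
    have hle : (Submodule.span ℂ (Set.range Φ)).topologicalClosure ≤ hardySpace σ :=
      Submodule.topologicalClosure_minimal _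
        (Submodule.span_le.mpr (Set.range_subset_iff.mpr hΦH))
        (Submodule.isClosed_topologicalClosure _)
    exact hle hq
  · rintro ⟨q, -, h⟩
    refine ⟨hpos, ?_⟩
    -- Comparing `Φ` with itself replaces `q` by an element of the closed span of `Φ` with the same
    -- Cauchy integral, so density of that span in `H²(σ)` is not needed.
    obtain ⟨q', hq', h'⟩ := exists_mem_closure_span_inner_eq (Φ₁ := Φ) (Φ₂ := Φ)
      (fun _ _ => rfl) q
    exact key.mpr ⟨q', hq', fun z => by rw [← h', hin, h]⟩

/-! ### Annihilating measures and equality of Cauchy integrals. -/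

/-- The Cauchy kernels lie in the polydisc algebra and suffice to test annihilation, by
`map_polydiscAlgebra_eq_zero`. Conjugating the measure matches holomorphic test functions with the
factor `conj C(ζ, z)`. -/
lemma conjMeasure_mem_annihilator_iff {σ₁ σ₂ : Measure (Torus n)} {h₁ h₂ : Torus n → ℂ}
    (hh₁ : Integrable h₁ σ₁) (hh₂ : Integrable h₂ σ₂) :
    conjMeasure (σ₁.withDensityᵥ h₁ - σ₂.withDensityᵥ h₂) ∈ annihilator n ↔
      ∀ z ∈ polydisc n, ∫ ζ, conj (cauchyKernel ζ.toVec z) * h₁ ζ ∂σ₁ =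
        ∫ ζ, conj (cauchyKernel ζ.toVec z) * h₂ ζ ∂σ₂ := by
  have hint : ∀ g : C(Torus n, ℂ), VectorMeasure.integral
      (conjMeasure (σ₁.withDensityᵥ h₁ - σ₂.withDensityᵥ h₂)) (fun ζ => g ζ)
      (ContinuousLinearMap.mul ℝ ℂ) =
      ∫ ζ, g ζ * conj (h₁ ζ) ∂σ₁ - ∫ ζ, g ζ * conj (h₂ ζ) ∂σ₂ := fun g =>
    integral_conjMeasure_withDensityᵥ_sub σ₁ σ₂ hh₁ hh₂ g.continuous.stronglyMeasurable
      g.norm_coe_le_norm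
  have hconj : ∀ (σ : Measure (Torus n)) (h : Torus n → ℂ) z,
      ∫ ζ, cauchyKernel ζ.toVec z * conj (h ζ) ∂σ =
        conj (∫ ζ, conj (cauchyKernel ζ.toVec z) * h ζ ∂σ) := fun σ h z => by
    rw [← integral_conj]
    simp
  have hcauchy : ∀ z ∈ polydisc n,
      (∫ ζ, cauchyMap (star z) ζ * conj (h₁ ζ) ∂σ₁ -
        ∫ ζ, cauchyMap (star z) ζ * conj (h₂ ζ) ∂σ₂ = 0 ↔
      ∫ ζ, conj (cauchyKernel ζ.toVec z) * h₁ ζ ∂σ₁ =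
        ∫ ζ, conj (cauchyKernel ζ.toVec z) * h₂ ζ ∂σ₂) := fun z hz => by
    simp only [cauchyMap_star_apply hz, hconj, ← map_sub, map_eq_zero, sub_eq_zero]
  constructor
  · intro h z hz
    have h0 := h (fun x => cauchyKernel x z) (cauchyKernel_mem_polydiscAlgebra hz)
    have h1 : (fun ζ : Torus n => cauchyKernel ζ.toVec z) = fun ζ => cauchyMap (star z) ζ :=
      funext fun ζ => (cauchyMap_star_apply hz ζ).symm
    rw [h1] at h0
    exact (hcauchy z hz).mp ((hint _).symm.trans h0)
  · intro h f hf
    have h₁' : Integrable (fun x => conj (h₁ x)) σ₁ :=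
      (LinearIsometryEquiv.integrable_comp_iff RCLike.conjLIE).mpr hh₁
    have h₂' : Integrable (fun x => conj (h₂ x)) σ₂ :=
      (LinearIsometryEquiv.integrable_comp_iff RCLike.conjLIE).mpr hh₂
    have h0 := map_polydiscAlgebra_eq_zero (integralMulCLM σ₁ h₁' - integralMulCLM σ₂ h₂')
      (fun v hv => by
        have := (hcauchy (star v) (star_mem_polydisc hv)).mpr (h _ (star_mem_polydisc hv))
        simpa using this) hf
    exact (hint ⟨fun ζ => f ζ.toVec, continuous_comp_toVec hf⟩).trans h0

lemma integrable_cauchyKernel (σ : Measure (Torus n)) [IsFiniteMeasure σ] {w : Fin n → ℂ}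
    (hw : w ∈ polydisc n) : Integrable (fun ζ : Torus n => cauchyKernel ζ.toVec w) σ := by
  simp only [← cauchyMap_star_apply hw]
  exact (cauchyMap (star w)).continuous.integrable_of_hasCompactSupport
    (HasCompactSupport.of_compactSpace _)

lemma deBrangesRovnyak_iff_annihilator {α : ℂ} (hα : ‖α‖ = 1) {b₁ b₂ : (Fin n → ℂ) → ℂ}
    (hb₁ : IsNonconstantSelfMap b₁) (hb₂ : IsNonconstantSelfMap b₂) {σ₁ σ₂ : Measure (Torus n)}
    (hσ₁ : IsClarkMeasure α b₁ σ₁) (hσ₂ : IsClarkMeasure α b₂ σ₂) {w : Fin n → ℂ}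
    (hw : w ∈ polydisc n) :
    (fun z : polydisc n => (α - b₂ z) / (α - b₁ z) * dbrKernel b₁ z w) ∈ deBrangesRovnyak b₂ ↔
      ∃ q ∈ hardySpace σ₂, conjMeasure (σ₁.withDensityᵥ (fun ζ => cauchyKernel ζ.toVec w) -
        σ₂.withDensityᵥ (fun ζ => q ζ)) ∈ annihilator n := by
  have := hσ₁.isFiniteMeasure
  have := hσ₂.isFiniteMeasure
  have hq : ∀ q : Lp ℂ 2 σ₂, Integrable (fun ζ => q ζ) σ₂ := fun q =>
    (Lp.memLp q).integrable (by norm_num)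
  have hαα : α * conj α = 1 := by rw [Complex.mul_conj']; simp [hα]
  have hα0 : α ≠ 0 := left_ne_zero_of_mul_eq_one hαα
  -- The part of the polarized identity depending only on `w`; it is nonzero, so it can be moved
  -- into `q`.
  set c : ℂ := 1 - α * conj (b₁ w)
  have hc : c ≠ 0 := one_sub_mul_ne_zero hα.le (by simpa using hb₁.mapsTo w hw)
  have hfac : ∀ x : ℂ, α - x = α * (1 - conj α * x) := fun x => by
    linear_combination x * hαα
  have hleft : ∀ z : polydisc n, (α - b₂ z) / (α - b₁ z) * dbrKernel b₁ z w =
      (1 - conj α * b₂ z) *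
        (c * ∫ ζ, conj (cauchyKernel ζ.toVec z) * cauchyKernel ζ.toVec w ∂σ₁) := fun z => by
    have h1 := one_sub_conj_mul_ne_zero hα (hb₁.mapsTo z z.2)
    rw [hfac, hfac, ← hσ₁.integral_cauchyKernel hα hb₁ z.2 hw]
    field_simp
    ring
  have hsmul : ∀ (a : ℂ) (q : Lp ℂ 2 σ₂) (z : Fin n → ℂ),
      ∫ ζ, conj (cauchyKernel ζ.toVec z) * (a • q : Lp ℂ 2 σ₂) ζ ∂σ₂ =
        a * ∫ ζ, conj (cauchyKernel ζ.toVec z) * q ζ ∂σ₂ := fun a q z => by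
    rw [← integral_const_mul]
    refine integral_congr_ae ?_
    filter_upwards [Lp.coeFn_smul a q] with ζ hζ
    rw [hζ, Pi.smul_apply, smul_eq_mul]
    ring
  rw [hσ₂.mem_deBrangesRovnyak_iff hα hb₂]
  simp only [conjMeasure_mem_annihilator_iff (integrable_cauchyKernel σ₁ hw) (hq _), hleft]
  constructor
  · rintro ⟨q, hqH, h⟩
    refine ⟨c⁻¹ • q, Submodule.smul_mem _ _ hqH, fun z hz => ?_⟩
    have h1 := mul_left_cancel₀ (one_sub_conj_mul_ne_zero hα (hb₂.mapsTo z hz)) (h ⟨z, hz⟩)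
    rw [hsmul, h1, inv_mul_cancel_left₀ hc]
  · rintro ⟨q, hqH, h⟩
    refine ⟨c • q, Submodule.smul_mem _ _ hqH, fun z => ?_⟩
    rw [hsmul, h z z.2]

/-! ### Restriction to null sets of the annihilator. -/

/-- If two measures with continuous non-vanishing, respectively square integrable, densities agree
on the subsets of `N`, then the first is absolutely continuous there, with density in `L²`. -/
lemma absolutelyContinuous_and_memLp_of_setIntegral_eq {σ₁ σ₂ : Measure (Torus n)}
    [IsFiniteMeasure σ₁] [IsFiniteMeasure σ₂] (c : C(Torus n, ℂ)) (hc : ∀ ζ, c ζ ≠ 0)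
    {q : Torus n → ℂ} (hq : MemLp q 2 σ₂) {N : Set (Torus n)} (hN : MeasurableSet N)
    (h : ∀ E ⊆ N, MeasurableSet E → ∫ ζ in E, c ζ ∂σ₁ = ∫ ζ in E, q ζ ∂σ₂) :
    (σ₁.restrict N).AbsolutelyContinuous σ₂ ∧
      MemLp (fun ζ => ((σ₁.restrict N).rnDeriv σ₂ ζ).toReal) 2 σ₂ := by
  have hci : ∀ (m : Measure (Torus n)) [IsFiniteMeasure m], Integrable c m := fun m _ =>
    c.continuous.integrable_of_hasCompactSupport (HasCompactSupport.of_compactSpace _)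
  have hac : (σ₁.restrict N).AbsolutelyContinuous σ₂ := by
    refine Measure.AbsolutelyContinuous.mk fun s hs hs0 => ?_
    -- All integrals of `c` over subsets of `s ∩ N` equal integrals of `q` over `σ₂`-null sets, so
    -- `c = 0` almost everywhere there. As `c` has no zeros, `s ∩ N` must be `σ₁`-null.
    have h0 : c =ᵐ[σ₁.restrict (s ∩ N)] 0 := by
      refine (hci _).ae_eq_zero_of_forall_setIntegral_eq_zero fun t ht _ => ?_
      rw [Measure.restrict_restrict ht,
        h _ (Set.inter_subset_right.trans Set.inter_subset_right) (ht.inter (hs.inter hN))]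
      refine setIntegral_measure_zero _ (measure_mono_null ?_ hs0)
      exact Set.inter_subset_right.trans Set.inter_subset_left
    have h1 : ∀ᵐ _ ∂σ₁.restrict (s ∩ N), False := h0.mono fun ζ hζ => hc ζ hζ
    rw [Measure.restrict_apply hs]
    simpa using h1
  refine ⟨hac, ?_⟩
  have : (σ₁.restrict N).HaveLebesgueDecomposition σ₂ :=
    Measure.haveLebesgueDecomposition_of_sigmaFinite _ _
  set g := fun ζ => ((σ₁.restrict N).rnDeriv σ₂ ζ).toReal
  have hqi : Integrable q σ₂ := hq.integrable (by norm_num)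
  have hgc : (fun ζ => g ζ • c ζ) =ᵐ[σ₂] N.indicator q := by
    refine Integrable.ae_eq_of_forall_setIntegral_eq _ _
      ((integrable_rnDeriv_smul_iff hac).mpr (hci _)) (hqi.indicator hN) fun s hs _ => ?_
    rw [setIntegral_rnDeriv_smul hac hs, Measure.restrict_restrict hs,
      h _ Set.inter_subset_right (hs.inter hN), setIntegral_indicator hN]
  -- The inverse of `c` is bounded by compactness of the torus, so `g c = 1_N q` gives `‖g‖ ≤ ‖d‖
  -- ‖q‖` almost everywhere.
  set d : C(Torus n, ℂ) := ⟨fun ζ => (c ζ)⁻¹, c.continuous.inv₀ hc⟩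
  refine hq.of_le_mul (c := ‖d‖)
    (Measure.measurable_rnDeriv _ _).ennreal_toReal.aestronglyMeasurable ?_
  filter_upwards [hgc] with ζ hζ
  have h1 : ‖g ζ‖ = ‖d ζ‖ * ‖N.indicator q ζ‖ := by
    rw [← hζ, norm_smul, mul_left_comm, ← norm_mul]
    simp [d, hc ζ]
  rw [h1]
  gcongr
  · exact d.norm_coe_le_norm ζ
  · exact norm_indicator_le_norm_self _ _

lemma setIntegral_eq_of_conjMeasure_mem_annihilator {σ₁ σ₂ : Measure (Torus n)}
    {h₁ h₂ : Torus n → ℂ} (hh₁ : Integrable h₁ σ₁) (hh₂ : Integrable h₂ σ₂)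
    (h : conjMeasure (σ₁.withDensityᵥ h₁ - σ₂.withDensityᵥ h₂) ∈ annihilator n)
    {N : Set (Torus n)} (hN : IsAnnihilatorNull N) {E : Set (Torus n)} (hEN : E ⊆ N)
    (hE : MeasurableSet E) : ∫ ζ in E, h₁ ζ ∂σ₁ = ∫ ζ in E, h₂ ζ ∂σ₂ := by
  have h0 := (VectorMeasure.variation_apply_eq_zero hN.1).mp (hN.2 _ h) E hEN hE
  rw [conjMeasure_apply, map_eq_zero, _root_.sub_apply, withDensityᵥ_apply hh₁ hE,
    withDensityᵥ_apply hh₂ hE] at h0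
  exact sub_eq_zero.mp h0

end ClarkTorus

end

theorem mainTheorem4 (n : ℕ) (b₁ b₂ : (Fin n → ℂ) → ℂ)
    (hb₁ : ClarkTorus.IsNonconstantSelfMap b₁) (hb₂ : ClarkTorus.IsNonconstantSelfMap b₂) :
    (∀ σ₁ σ₂ : Measure (ClarkTorus.Torus n),
      ClarkTorus.IsClarkMeasure 1 b₁ σ₁ → ClarkTorus.IsClarkMeasure 1 b₂ σ₂ →
      ∀ w ∈ ClarkTorus.polydisc n,
        ((fun z : ClarkTorus.polydisc n =>
            (1 - b₂ z) / (1 - b₁ z) * ClarkTorus.dbrKernel b₁ z w) ∈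
              ClarkTorus.deBrangesRovnyak b₂ ↔
          ∃ q ∈ ClarkTorus.hardySpace σ₂,
            ClarkTorus.conjMeasure
              (σ₁.withDensityᵥ (fun ζ => ClarkTorus.cauchyKernel ζ.toVec w) -
                σ₂.withDensityᵥ (fun ζ => q ζ)) ∈ ClarkTorus.annihilator n)) ∧
    (∀ α : ℂ, ‖α‖ = 1 → ∀ σ₁ σ₂ : Measure (ClarkTorus.Torus n),
      ClarkTorus.IsClarkMeasure α b₁ σ₁ → ClarkTorus.IsClarkMeasure α b₂ σ₂ →
      (∃ w ∈ ClarkTorus.polydisc n,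
        (fun z : ClarkTorus.polydisc n =>
          (α - b₂ z) / (α - b₁ z) * ClarkTorus.dbrKernel b₁ z w) ∈
            ClarkTorus.deBrangesRovnyak b₂) →
      ∀ N : Set (ClarkTorus.Torus n), ClarkTorus.IsAnnihilatorNull N →
        (σ₁.restrict N).AbsolutelyContinuous σ₂ ∧
        MemLp (fun ζ => ((σ₁.restrict N).rnDeriv σ₂ ζ).toReal) 2 σ₂) := by
  refine ⟨fun σ₁ σ₂ hσ₁ hσ₂ w hw =>
    ClarkTorus.deBrangesRovnyak_iff_annihilator norm_one hb₁ hb₂ hσ₁ hσ₂ hw, ?_⟩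
  rintro α hα σ₁ σ₂ hσ₁ hσ₂ ⟨w, hw, hmem⟩ N hN
  have := hσ₁.isFiniteMeasure
  have := hσ₂.isFiniteMeasure
  obtain ⟨q, -, hq⟩ :=
    (ClarkTorus.deBrangesRovnyak_iff_annihilator hα hb₁ hb₂ hσ₁ hσ₂ hw).mp hmem
  refine ClarkTorus.absolutelyContinuous_and_memLp_of_setIntegral_eq
    (ClarkTorus.cauchyMap (star w)) (fun ζ => ?_) (Lp.memLp q) hN.1 fun E hEN hE => ?_
  · rw [ClarkTorus.cauchyMap_star_apply hw]
    exact ClarkTorus.cauchyKernel_ne_zero ζ.toVec_mem_closedPolydisc hw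
  · simp only [ClarkTorus.cauchyMap_star_apply hw]
    exact ClarkTorus.setIntegral_eq_of_conjMeasure_mem_annihilator
      (ClarkTorus.integrable_cauchyKernel σ₁ hw) ((Lp.memLp q).integrable (by norm_num)) hq hN
      hEN hE
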